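/- Consider words over the alphabet of four symbols consisting of an opening and a closing parenthesis of each of two types. Let $\mathrm{DYCK}(2)$ be the language of well-parenthesized words over this alphabet, and let $L=\mathrm{DYCK}(2)_3$ be the language of those words of $\mathrm{DYCK}(2)$ that can be written as $u_1v_1u_2v_2u_3v_3$, where the (possibly empty) words $u_i$ consist only of opening parentheses and the (possibly empty) words $v_i$ consist only of closing parentheses. For $n\in\mathbb{N}$ and words $x=x_1\cdots x_n$, $y=y_1\cdots y_n$ of length $n$ let $f_n(x,y)=1$ if the word $xy$ of length $2n$ belongs to $L$, and $f_n(x,y)=0$ otherwise. A (randomized, one-pass) streaming algorithm with $S$ bits of memory has memory contents in $\{0,1\}^S$; the initial content, the new content after reading a symbol (a function of the old content and the symbol), and the output bit at the end of the stream (a function of the final content) may all depend on an infinite string $r$ of independent fair random bits, which can be read at any time and is not counted as memory. It computes $f_n$ with error $\varepsilon$ if, for every input $(x,y)$, it outputs $f_n(x,y)$ with probability at least $1-\varepsilon$. The algorithm may depend on $n$. Fix a constant error $0<\varepsilon<\tfrac12$. Then: 1. If the two inputs are concatenated, i.e. the stream is $x_1,\ldots,x_n,y_1,\ldots,y_n$,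 there is a streaming algorithm that computes $f_n$ with error $\varepsilon$ and $O(\log n)$ bits of memory. It can be chosen so that only its initial memory content depends on $r$. 2. If the two inputs are interleaved, i.e. the stream is $x_1,y_1,x_2,y_2,\ldots,x_n,y_n$, every streaming algorithm that computes $f_n$ with error $\varepsilon$ uses $\Omega(n)$ bits of memory. The constants in $O(\cdot)$ and $\Omega(\cdot)$ depend only on $\varepsilon$. -/

import Mathlib

/-! ### Streams made of two inputs -/

/-- The stream `x₁, …, xₙ, y₁, …, yₙ`. -/
def concatStream {A : Type} {n : ℕ} (x y : Fin n → A) : List A :=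
  List.ofFn x ++ List.ofFn y

/-- The stream `x₁, y₁, x₂, y₂, …, xₙ, yₙ`. -/
def interleavedStream {A : Type} {n : ℕ} (x y : Fin n → A) : List A :=
  (List.finRange n).flatMap fun i => [x i, y i]

/-! ### Randomized one-pass streaming algorithms -/

/-- An infinite string of random bits. -/
abbrev CoinString : Type := ℕ → Bool

/-- The law of an infinite string of independent fair coin tosses. -/
noncomputable def coinMeasure : MeasureTheory.Measure CoinString :=
  MeasureTheory.Measure.infinitePi fun _ : ℕ => (PMF.uniformOfFintype Bool).toMeasure

/-- A randomized one-pass streaming algorithm over the alphabet `A` with `S` bits of memory.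
The memory content is updated once per symbol of the stream, and a bit is output at the end of
the stream. The infinite random string `r` can be consulted at every time, at no memory cost. -/
structure StreamAlg (A : Type) (S : ℕ) where
  /-- initial memory content -/
  init : CoinString → (Fin S → Bool)
  /-- update of the memory content when a symbol is read -/
  step : CoinString → (Fin S → Bool) → A → (Fin S → Bool)
  /-- the answer given at the end of the stream -/
  output : CoinString → (Fin S → Bool) → Bool
  measurable_init : Measurable init
  measurable_step : ∀ σ a, Measurable fun r => step r σ a
  measurable_output : ∀ σ, Measurable fun r => output r σ

namespace StreamAlg

/-- The answer of the algorithm on the stream `s` when the random string is `r`. -/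
def run {A : Type} {S : ℕ} (M : StreamAlg A S) (r : CoinString) (s : List A) : Bool :=
  M.output r (s.foldl (M.step r) (M.init r))

/-- The algorithm computes `f` with error at most `ε` when the two inputs `x`, `y` are presented
as the single stream `stream x y`: on every input the answer is wrong with probability at
most `ε`. -/
def Computes {A : Type} {S n : ℕ} (M : StreamAlg A S) (ε : ℝ)
    (stream : (Fin n → A) → (Fin n → A) → List A)
    (f : (Fin n → A) → (Fin n → A) → Bool) : Prop :=
  ∀ x y, coinMeasure.real {r | M.run r (stream x y) ≠ f x y} ≤ ε

/-- The random string is used only to choose the initial memory content, so that every random bit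
that is needed later has to be stored in the memory. -/
def CoinsOnlyAtStart {A : Type} {S : ℕ} (M : StreamAlg A S) : Prop :=
  ∀ r r', M.step r = M.step r' ∧ M.output r = M.output r'

end StreamAlg

/-! ### The language of well-parenthesized words with three alternations -/

/-- Opening and closing parentheses of two types. -/
inductive Paren : Type
  | op (t : Bool)
  | cl (t : Bool)

/-- Well-parenthesized words: generated from the empty word by enclosing a word in a pair of
parentheses of the same type, and by concatenation. -/
inductive WellParenthesized : List Paren → Prop
  | nil : WellParenthesized []
  | enclose (t : Bool) {w : List Paren} (hw : WellParenthesized w) :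
      WellParenthesized ([Paren.op t] ++ w ++ [Paren.cl t])
  | append {w w' : List Paren} (hw : WellParenthesized w) (hw' : WellParenthesized w') :
      WellParenthesized (w ++ w')

/-- The language DYCK(2). -/
def dyckTwo : Language Paren := {w | WellParenthesized w}

/-- The word is made only of opening parentheses. -/
def AllOpening (w : List Paren) : Prop := ∀ p ∈ w, ∃ t, p = Paren.op t

/-- The word is made only of closing parentheses. -/
def AllClosing (w : List Paren) : Prop := ∀ p ∈ w, ∃ t, p = Paren.cl t

/-- The language of the words `u₁v₁u₂v₂u₃v₃` of DYCK(2) where the `uᵢ` are made only of opening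
parentheses and the `vᵢ` only of closing ones. -/
def dyckTwoThree : Language Paren :=
  {w | w ∈ dyckTwo ∧ ∃ u₁ v₁ u₂ v₂ u₃ v₃ : List Paren,
    w = u₁ ++ v₁ ++ u₂ ++ v₂ ++ u₃ ++ v₃ ∧
    AllOpening u₁ ∧ AllClosing v₁ ∧ AllOpening u₂ ∧ AllClosing v₂ ∧ AllOpening u₃ ∧ AllClosing v₃}

open Classical in
/-- The indicator function of `dyckTwoThree` on words of length `2n`, as a function of the first
half `x` and the second half `y` of the word. -/
noncomputable def dyckFun (n : ℕ) (x y : Fin n → Paren) : Bool :=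
  decide (List.ofFn x ++ List.ofFn y ∈ dyckTwoThree)

/-! Both bounds start from `mem_dyckTwoThree_iff`: membership means that every closing parenthesis
matches the top of a stack, the stack ends empty, and there are at most three blocks of opening
parentheses.

Interleaved streams reduce from augmented indexing: recover the bit `a i` from a message about `a`,
knowing `i` and the bits before `i`. The word `x` pushes `a` with its first letter on top, pops the
letters before `i`, closes and reopens a `true` parenthesis, and pushes the popped letters back; `y`
pops `a`. By `probeInput_append_mem_iff` the word is in the language exactly when `a i` is `true`.
The first `2m` interleaved symbols depend on `a` alone, and the rest only on `i` and the bits before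
`i`, so the memory at the cut is such a message. Fixing good coins by averaging leaves a
deterministic code with error rate at most `ε`, and counting (`sum_pow_errors_le`,
`entropy_le_of_errors_le`) forces `S * log 2 ≥ m * (log 2 - H(ε))`.

For concatenated streams, store the positions of the unmatched parentheses but not their types.
Opening at position `p` subtracts its letter times `z ^ p`; closing it adds the closing letter times
`z ^ p`. For words of balanced shape, the resulting polynomial in `z` vanishes iff all types agree
(`FingerprintState.matches_iff_hash_eq`). Its degree is at most `2n`, so a random `z` in a field of
size `O(n)` detects an error with high probability. Three blocks of openings make the stack a union
of three intervals (`FingerprintState.Reachable.exists_decode`), hence logarithmic memory; `z` is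
stored too, so coins are needed only at the start. -/

/-! ### Well-parenthesized words and stacks -/

/-- Reading the word on top of the given stack of unmatched opening parentheses, every closing
parenthesis matches the top of the stack, and the stack is empty at the end. -/
def Matches : List Bool → List Paren → Prop
  | s, [] => s = []
  | s, .op t :: w => Matches (t :: s) w
  | [], .cl _ :: _ => False
  | t' :: s, .cl t :: w => t = t' ∧ Matches s w

theorem matches_op_append (l s : List Bool) (w : List Paren) :
    Matches s (l.map Paren.op ++ w) ↔ Matches (l.reverse ++ s) w := by
  induction l generalizing s with
  | nil => simp
  | cons t l ih => simp [Matches, ih]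

theorem matches_cl_append (l s : List Bool) (w : List Paren) :
    Matches (l ++ s) (l.map Paren.cl ++ w) ↔ Matches s w := by
  induction l with
  | nil => simp
  | cons t l ih => simp [Matches, ih]

theorem matches_replicate (p : ℕ) (s : List Bool) (w : List Paren) :
    Matches s (List.replicate p (Paren.op true) ++ List.replicate p (Paren.cl true) ++ w) ↔
      Matches s w := by
  have h₁ := matches_op_append (List.replicate p true) s
    (List.replicate p (Paren.cl true) ++ w)
  have h₂ := matches_cl_append (List.replicate p true) s w
  simp only [List.map_replicate, List.reverse_replicate] at h₁ h₂
  rw [List.append_assoc, h₁, h₂]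

theorem WellParenthesized.matches_append {v : List Paren} (hv : WellParenthesized v)
    (s : List Bool) (w : List Paren) : Matches s (v ++ w) ↔ Matches s w := by
  induction hv generalizing s w with
  | nil => simp
  | enclose t _ ih => simp [Matches, ih]
  | append _ _ ih ih' => simp [ih, ih']

/-- Undoes one pop of the stack: in `wellParenthesized_of_matches` the top opening parenthesis and
the closing one just read are adjacent and can be inserted last. -/
theorem WellParenthesized.insert_pair {v : List Paren} (hv : WellParenthesized v) (t : Bool) :
    ∀ a b : List Paren, v = a ++ b → WellParenthesized (a ++ [Paren.op t, Paren.cl t] ++ b) := by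
  have pair : WellParenthesized [Paren.op t, Paren.cl t] := .enclose t .nil
  induction hv with
  | nil =>
    intro a b h
    obtain ⟨rfl, rfl⟩ := List.append_eq_nil_iff.mp h.symm
    simpa using pair
  | @enclose t' w hw ih =>
    intro a b h
    rcases a with _ | ⟨p, a⟩
    · obtain rfl : _ = b := h
      exact pair.append (.enclose t' hw)
    · rcases List.eq_nil_or_concat b with rfl | ⟨b, q, rfl⟩
      · rw [List.append_nil] at h ⊢
        rw [← h]
        exact .append (.enclose t' hw) pair
      · have h' : Paren.op t' :: (w ++ [Paren.cl t']) = p :: ((a ++ b) ++ [q]) := by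
          simpa using h
        obtain ⟨rfl, h''⟩ := List.cons.inj h'
        obtain ⟨hw', hq⟩ := List.append_inj' h'' rfl
        obtain rfl := (List.cons.inj hq).1
        simpa using WellParenthesized.enclose t' (ih a b hw')
  | @append w w' hw hw' ih ih' =>
    intro a b h
    rcases List.append_eq_append_iff.mp h with ⟨c, rfl, rfl⟩ | ⟨c, rfl, rfl⟩
    · simpa using hw.append (ih' c b rfl)
    · simpa using (ih a c rfl).append hw'

theorem wellParenthesized_of_matches (s : List Bool) (w : List Paren) (h : Matches s w) :
    WellParenthesized (s.reverse.map Paren.op ++ w) := by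
  induction w generalizing s with
  | nil =>
    obtain rfl : s = [] := h
    exact .nil
  | cons p w ih =>
    cases p with
    | op t => simpa using ih (t :: s) h
    | cl t =>
      cases s with
      | nil => exact h.elim
      | cons t' s =>
        obtain ⟨rfl, h⟩ := h
        simpa using (ih s h).insert_pair t _ _ rfl

theorem wellParenthesized_iff_matches (w : List Paren) : WellParenthesized w ↔ Matches [] w :=
  ⟨fun h => by simpa [Matches] using h.matches_append [] [],
    fun h => by simpa using wellParenthesized_of_matches [] w h⟩

/-! ### Counting the blocks of opening parentheses -/

/-- The number of opening parentheses that are not preceded by an opening parenthesis; the flag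
tells whether the first symbol is considered to be preceded by one. -/
def openingBlocks : Bool → List Paren → ℕ
  | _, [] => 0
  | true, .op _ :: w => openingBlocks true w
  | false, .op _ :: w => openingBlocks true w + 1
  | _, .cl _ :: w => openingBlocks false w

/-- The word is a concatenation of `k` words, each made of opening parentheses followed by closing
parentheses. -/
def HasBlocks : ℕ → List Paren → Prop
  | 0, w => w = []
  | k + 1, w => ∃ u v w', w = u ++ v ++ w' ∧ AllOpening u ∧ AllClosing v ∧ HasBlocks k w'

theorem allOpening_nil : AllOpening [] := by simp [AllOpening]

theorem allClosing_nil : AllClosing [] := by simp [AllClosing]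

theorem hasBlocks_nil (k : ℕ) : HasBlocks k [] := by
  induction k with
  | zero => rfl
  | succ k ih => exact ⟨[], [], [], rfl, allOpening_nil, allClosing_nil, ih⟩

theorem HasBlocks.cons_op {k : ℕ} {w : List Paren} (h : HasBlocks (k + 1) w) (t : Bool) :
    HasBlocks (k + 1) (Paren.op t :: w) := by
  obtain ⟨u, v, w', rfl, hu, hv, hw⟩ := h
  exact ⟨.op t :: u, v, w', by simp, by simpa [AllOpening] using hu, hv, hw⟩

/-- The two claims are proved together because they feed each other: after an opening symbol the
current block is already paid for, and after a closing symbol further closing ones are free. -/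
theorem hasBlocks_of_openingBlocks_le (w : List Paren) :
    (∀ k, openingBlocks true w ≤ k → HasBlocks (k + 1) w) ∧
      ∀ k, openingBlocks false w ≤ k → ∃ v w', w = v ++ w' ∧ AllClosing v ∧ HasBlocks k w' := by
  induction w with
  | nil =>
    exact ⟨fun k _ => hasBlocks_nil _, fun k _ => ⟨[], [], rfl, allClosing_nil, hasBlocks_nil k⟩⟩
  | cons p w ih =>
    cases p with
    | op t =>
      refine ⟨fun k hk => (ih.1 k hk).cons_op t, fun k hk => ?_⟩
      obtain _ | k := k
      · simp [openingBlocks] at hk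
      · exact ⟨[], _, rfl, allClosing_nil,
          (ih.1 k (by simpa [openingBlocks] using hk)).cons_op t⟩
    | cl t =>
      refine ⟨fun k hk => ?_, fun k hk => ?_⟩ <;>
        obtain ⟨v, w', rfl, hv, hw⟩ := ih.2 k hk
      · exact ⟨[], .cl t :: v, w', rfl, allOpening_nil, by simpa [AllClosing] using hv, hw⟩
      · exact ⟨.cl t :: v, w', rfl, by simpa [AllClosing] using hv, hw⟩

theorem openingBlocks_true_le (w : List Paren) :
    openingBlocks true w ≤ openingBlocks false w := by
  rcases w with _ | ⟨_ | _, w⟩ <;> simp [openingBlocks]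

theorem openingBlocks_false_le (w : List Paren) :
    openingBlocks false w ≤ openingBlocks true w + 1 := by
  rcases w with _ | ⟨_ | _, w⟩ <;> simp [openingBlocks]

theorem openingBlocks_opening_append {u : List Paren} (hu : AllOpening u) (w : List Paren) :
    openingBlocks true (u ++ w) = openingBlocks true w := by
  induction u with
  | nil => rfl
  | cons p u ih =>
    obtain ⟨⟨t, rfl⟩, hu'⟩ := List.forall_mem_cons.mp hu
    simpa [openingBlocks] using ih hu'

theorem openingBlocks_closing_append {v : List Paren} (hv : AllClosing v) (w : List Paren)
    (b : Bool) : openingBlocks b (v ++ w) ≤ openingBlocks false w := by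
  induction v generalizing b with
  | nil => cases b; exacts [le_rfl, openingBlocks_true_le w]
  | cons p v ih =>
    obtain ⟨⟨t, rfl⟩, hv'⟩ := List.forall_mem_cons.mp hv
    simpa [openingBlocks] using ih hv' false

theorem HasBlocks.openingBlocks_le {k : ℕ} {w : List Paren} (h : HasBlocks k w) :
    openingBlocks false w ≤ k := by
  induction k generalizing w with
  | zero => obtain rfl : w = [] := h; rfl
  | succ k ih =>
    obtain ⟨u, v, w', rfl, hu, hv, hw⟩ := h
    have h₁ := openingBlocks_false_le (u ++ v ++ w')
    rw [List.append_assoc, openingBlocks_opening_append hu] at h₁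
    have h₂ := openingBlocks_closing_append hv w' true
    have h₃ := ih hw
    rw [List.append_assoc]
    omega

theorem hasBlocks_three_iff (w : List Paren) : HasBlocks 3 w ↔
    ∃ u₁ v₁ u₂ v₂ u₃ v₃ : List Paren, w = u₁ ++ v₁ ++ u₂ ++ v₂ ++ u₃ ++ v₃ ∧
      AllOpening u₁ ∧ AllClosing v₁ ∧ AllOpening u₂ ∧ AllClosing v₂ ∧
      AllOpening u₃ ∧ AllClosing v₃ := by
  constructor
  · rintro ⟨u₁, v₁, _, rfl, hu₁, hv₁, u₂, v₂, _, rfl, hu₂, hv₂, u₃, v₃, _, rfl, hu₃, hv₃, rfl⟩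
    exact ⟨u₁, v₁, u₂, v₂, u₃, v₃, by simp, hu₁, hv₁, hu₂, hv₂, hu₃, hv₃⟩
  · rintro ⟨u₁, v₁, u₂, v₂, u₃, v₃, rfl, hu₁, hv₁, hu₂, hv₂, hu₃, hv₃⟩
    exact ⟨u₁, v₁, u₂ ++ v₂ ++ (u₃ ++ v₃ ++ []), by simp, hu₁, hv₁, u₂, v₂, _, rfl, hu₂, hv₂,
      u₃, v₃, [], rfl, hu₃, hv₃, rfl⟩

theorem mem_dyckTwoThree_iff (w : List Paren) :
    w ∈ dyckTwoThree ↔ Matches [] w ∧ openingBlocks false w ≤ 3 := by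
  have h : w ∈ dyckTwoThree ↔ WellParenthesized w ∧ HasBlocks 3 w := by
    rw [hasBlocks_three_iff]; rfl
  rw [h, wellParenthesized_iff_matches]
  refine and_congr_right fun hm => ⟨fun h => h.openingBlocks_le, fun h => ?_⟩
  rcases w with _ | ⟨t | t, w⟩
  · exact hasBlocks_nil 3
  · exact ((hasBlocks_of_openingBlocks_le w).1 2 (Nat.le_of_succ_le_succ h)).cons_op t
  -- A leading closing parenthesis would need a block with empty `u₁` that `openingBlocks` does not
  -- count; the empty stack excludes it.
  · exact hm.elim

/-! ### Measurability of the answer -/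

theorem measurable_foldl_of_discrete {Ω A Q : Type*} [MeasurableSpace Ω] [MeasurableSpace Q]
    [Countable Q] [MeasurableSingletonClass Q] (step : Ω → Q → A → Q)
    (hstep : ∀ q a, Measurable fun ω => step ω q a) (s : List A) (init : Ω → Q)
    (hinit : Measurable init) : Measurable fun ω => s.foldl (step ω) (init ω) := by
  induction s generalizing init with
  | nil => exact hinit
  | cons a s ih =>
    refine ih _ ?_
    have h : Measurable fun p : Q × Ω => step p.2 p.1 a :=
      measurable_from_prod_countable_right fun q => hstep q a
    exact h.comp (hinit.prodMk measurable_id)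

theorem StreamAlg.measurable_run {A : Type} {S : ℕ} (M : StreamAlg A S) (s : List A) :
    Measurable fun r => M.run r s := by
  have h : Measurable fun p : (Fin S → Bool) × CoinString => M.output p.2 p.1 :=
    measurable_from_prod_countable_right fun q => M.measurable_output q
  exact h.comp ((measurable_foldl_of_discrete M.step M.measurable_step s M.init
    M.measurable_init).prodMk measurable_id)

instance isProbabilityMeasure_coinMeasure : MeasureTheory.IsProbabilityMeasure coinMeasure := by
  unfold coinMeasure
  infer_instance

/-! ### A lower bound for augmented indexing -/

/-- A decoder that recovers the bit `a i` from an encoding `σ a` and the bits preceding it, with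
`E a` errors in total on `a`, needs `2 ^ m * ∑ₐ λ ^ E a ≤ |Q| * (1 + λ) ^ m`. -/
theorem sum_pow_errors_le {m : ℕ} {Q : Type*} [Fintype Q] (σ : (Fin m → Bool) → Q)
    (D : Q → Fin m → (Fin m → Bool) → Bool)
    (hD : ∀ q i a a', (∀ j < i, a j = a' j) → D q i a = D q i a') (l : ℝ) (hl : 0 ≤ l) :
    ∑ a, l ^ (Finset.univ.filter fun i => D (σ a) i a ≠ a i).card ≤
      Fintype.card Q * (1 + l) ^ m := by
  classical
  let E : (Fin m → Bool) → Finset (Fin m) := fun a => Finset.univ.filter fun i => D (σ a) i a ≠ a i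
  -- Bits are recovered in order: each guess uses only earlier bits, and the error set says whether
  -- to flip it.
  have hinj : Function.Injective fun a => (σ a, E a) := by
    intro a a' h
    obtain ⟨hσ, hE⟩ := Prod.mk.inj h
    have key : ∀ k : ℕ, ∀ hk : k < m, a ⟨k, hk⟩ = a' ⟨k, hk⟩ := by
      intro k
      induction k using Nat.strong_induction_on with
      | _ k ih =>
        intro hk
        have h₁ : D (σ a) ⟨k, hk⟩ a = D (σ a') ⟨k, hk⟩ a' := by
          rw [hσ]
          exact hD _ _ _ _ fun j hj => ih j hj j.2
        have h₂ : D (σ a) ⟨k, hk⟩ a ≠ a ⟨k, hk⟩ ↔ D (σ a') ⟨k, hk⟩ a' ≠ a' ⟨k, hk⟩ := by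
          have := Finset.ext_iff.mp hE ⟨k, hk⟩
          simpa [E] using this
        rw [h₁] at h₂
        revert h₂
        cases a ⟨k, hk⟩ <;> cases a' ⟨k, hk⟩ <;> cases D (σ a') ⟨k, hk⟩ a' <;> simp
    exact funext fun i => key i i.2
  calc ∑ a, l ^ (E a).card
      = ∑ p ∈ Finset.univ.image fun a => (σ a, E a), l ^ p.2.card := by
        rw [Finset.sum_image hinj.injOn]
    _ ≤ ∑ p : Q × Finset (Fin m), l ^ p.2.card :=
        Finset.sum_le_sum_of_subset_of_nonneg (Finset.subset_univ _) fun _ _ _ => by positivity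
    _ = Fintype.card Q * (1 + l) ^ m := by
        rw [Fintype.sum_prod_type]
        have := Fintype.sum_pow_mul_eq_add_pow (Fin m) l 1
        simp only [one_pow, mul_one, Fintype.card_fin] at this
        simp [this, add_comm]

/-- The counting bound is used with weight `ε / (1 - ε)`, for which the logarithm of the two sides
gives exactly the binary entropy. -/
theorem entropy_le_of_errors_le {m S : ℕ} {ε : ℝ} (hε₀ : 0 < ε) (hε₁ : ε < 1 / 2)
    (σ : (Fin m → Bool) → (Fin S → Bool))
    (D : (Fin S → Bool) → Fin m → (Fin m → Bool) → Bool)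
    (hD : ∀ q i a a', (∀ j < i, a j = a' j) → D q i a = D q i a')
    (herr : ∑ a, ((Finset.univ.filter fun i => D (σ a) i a ≠ a i).card : ℝ) ≤ ε * m * 2 ^ m) :
    m * (Real.log 2 - Real.binEntropy ε) ≤ S * Real.log 2 := by
  have hε : 0 < 1 - ε := by linarith
  set L : ℝ := Real.log (ε / (1 - ε)) with hL
  have hL₀ : L ≤ 0 := Real.log_nonpos (by positivity) (by rw [div_le_one hε]; linarith)
  have hcount := sum_pow_errors_le σ D hD (ε / (1 - ε)) (by positivity)
  set E : (Fin m → Bool) → ℕ := fun a => (Finset.univ.filter fun i => D (σ a) i a ≠ a i).card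
  -- Jensen's inequality, through the tangent of `exp` at `ε * m * L`. As `L ≤ 0`, fewer errors only
  -- enlarge the sum.
  have htangent : Real.exp (ε * m * L) * 2 ^ m ≤ ∑ a, (ε / (1 - ε)) ^ E a := by
    have h₁ : ∀ a, Real.exp (ε * m * L) * (1 + (E a * L - ε * m * L)) ≤
        (ε / (1 - ε)) ^ E a := by
      intro a
      have h₂ : (ε / (1 - ε)) ^ E a =
          Real.exp (ε * m * L) * Real.exp (E a * L - ε * m * L) := by
        rw [← Real.exp_add, ← Real.exp_log (show (0 : ℝ) < ε / (1 - ε) by positivity),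
          ← Real.exp_nat_mul]
        congr 1
        ring
      rw [h₂]
      gcongr
      linarith [Real.add_one_le_exp (E a * L - ε * m * L)]
    refine le_trans ?_ (Finset.sum_le_sum fun a _ => h₁ a)
    rw [← Finset.mul_sum]
    gcongr
    have h₃ : ∑ a : Fin m → Bool, (1 + ((E a : ℝ) * L - ε * m * L)) =
        2 ^ m + L * (∑ a, (E a : ℝ) - ε * m * 2 ^ m) := by
      simp [Finset.sum_add_distrib, ← Finset.sum_mul]
      ring
    rw [h₃]
    have := mul_nonneg_of_nonpos_of_nonpos hL₀ (sub_nonpos.mpr herr)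
    linarith
  have h := htangent.trans hcount
  have h1 : 1 + ε / (1 - ε) = (1 - ε)⁻¹ := by field_simp; ring
  rw [h1] at h
  have h2 := Real.log_le_log (by positivity) h
  rw [Real.log_mul (by positivity) (by positivity), Real.log_exp, Real.log_pow,
    Real.log_mul (by simp) (by positivity), Real.log_pow, Real.log_inv] at h2
  simp only [Fintype.card_pi, Fintype.card_bool, Finset.prod_const, Finset.card_univ,
    Fintype.card_fin, Nat.cast_pow, Nat.cast_ofNat, Real.log_pow] at h2
  rw [Real.binEntropy_eq_negMulLog_add_negMulLog_one_sub, Real.negMulLog, Real.negMulLog]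
  rw [hL, Real.log_div hε₀.ne' hε.ne'] at h2
  linarith

/-! ### Embedding augmented indexing into the language -/

theorem List.ofFn_get_cast {A : Type*} {n : ℕ} (l : List A) (hl : l.length = n) :
    List.ofFn (fun i : Fin n => l.get (i.cast hl.symm)) = l := by
  subst hl
  exact List.ofFn_get l

theorem interleavedStream_eq {A : Type} {n : ℕ} (x y : Fin n → A) :
    interleavedStream x y =
      ((List.ofFn x).zip (List.ofFn y)).flatMap fun p => [p.1, p.2] := by
  have h : (List.ofFn x).zip (List.ofFn y) = (List.finRange n).map fun i => (x i, y i) := by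
    rw [List.ofFn_eq_map, List.ofFn_eq_map, List.zip_map']
  rw [h, interleavedStream, List.flatMap_map]

/-- A word made of `p` pairs of nested parentheses. -/
def nestedPairs (p : ℕ) : List Paren :=
  List.replicate p (Paren.op true) ++ List.replicate p (Paren.cl true)

/-- Test whether the letter on top of the stack below `l` is `true`, and restore the stack. -/
def probeWord (p : ℕ) (l : List Bool) : List Paren :=
  nestedPairs p ++ l.map Paren.cl ++ [Paren.cl true, Paren.op true] ++ l.reverse.map Paren.op

/-- Once `l` is popped the top is `t`, so closing a `true` parenthesis succeeds only for `t = true`;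
what follows restores the stack and empties it. The nested pairs are padding, placed so that only
three blocks arise. -/
theorem mem_dyckTwoThree_probe (p q : ℕ) (l l' : List Bool) (t : Bool) :
    ((l ++ t :: l').reverse.map Paren.op ++ probeWord p l) ++
      ((l ++ t :: l').map Paren.cl ++ nestedPairs q) ∈ dyckTwoThree ↔ t = true := by
  have hm : Matches [] (((l ++ t :: l').reverse.map Paren.op ++ probeWord p l) ++
      ((l ++ t :: l').map Paren.cl ++ nestedPairs q)) ↔ t = true := by
    have h₁ := matches_replicate p (l ++ t :: l')
      (l.map Paren.cl ++ ([Paren.cl true, Paren.op true] ++ (l.reverse.map Paren.op ++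
      ((l ++ t :: l').map Paren.cl ++ nestedPairs q))))
    have h₂ := matches_cl_append (l ++ true :: l') [] (nestedPairs q)
    have h₃ : Matches [] (nestedPairs q) := by
      simpa [nestedPairs, Matches] using matches_replicate q [] []
    rw [List.append_assoc, matches_op_append]
    simp only [probeWord, nestedPairs, List.append_assoc, List.reverse_reverse,
      List.append_nil] at h₁ h₂ h₃ ⊢
    rw [h₁, matches_cl_append]
    simp only [List.cons_append, List.nil_append, Matches]
    rw [matches_op_append, List.reverse_reverse]
    refine ⟨fun h => h.1.symm, ?_⟩
    rintro rfl
    exact ⟨rfl, h₂.mpr h₃⟩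
  rw [← hm]
  refine ⟨fun h => (wellParenthesized_iff_matches _).mp h.1,
    fun h => ⟨(wellParenthesized_iff_matches _).mpr h,
      (l ++ t :: l').reverse.map Paren.op ++ List.replicate p (Paren.op true),
      List.replicate p (Paren.cl true) ++ l.map Paren.cl ++ [Paren.cl true],
      Paren.op true :: l.reverse.map Paren.op, (l ++ t :: l').map Paren.cl,
      List.replicate q (Paren.op true), List.replicate q (Paren.cl true),
      by simp [probeWord, nestedPairs], ?_⟩⟩
  refine ⟨?_, ?_, ?_, ?_, ?_, ?_⟩ <;> intro s hs <;>
    simp only [List.mem_append, List.mem_map, List.mem_replicate, List.mem_cons] at hs <;> grind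

/-- The first input encoding the string `a` and the index `i`. -/
def probeInput {m : ℕ} (q : ℕ) (a : Fin m → Bool) (i : Fin m) : List Paren :=
  (List.ofFn a).reverse.map Paren.op ++ probeWord (q - 1 - i) ((List.ofFn a).take i)

/-- The second input encoding the string `a`. -/
def closingInput {m : ℕ} (q : ℕ) (a : Fin m → Bool) : List Paren :=
  (List.ofFn a).map Paren.cl ++ nestedPairs q

/-- The padding makes the length independent of `i`; `m ≤ q` ensures that `q - 1 - i` is not
truncated. -/
theorem length_probeInput {m q : ℕ} (hmq : m ≤ q) (a : Fin m → Bool) (i : Fin m) :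
    (probeInput q a i).length = m + 2 * q := by
  have := i.2
  simp only [probeInput, probeWord, nestedPairs, List.length_append, List.length_map,
    List.length_reverse, List.length_ofFn, List.length_replicate, List.length_take,
    List.length_cons, List.length_nil]
  omega

theorem length_closingInput {m q : ℕ} (a : Fin m → Bool) :
    (closingInput q a).length = m + 2 * q := by
  simp [closingInput, nestedPairs]
  omega

theorem probeInput_append_mem_iff {m : ℕ} (q : ℕ) (a : Fin m → Bool) (i : Fin m) :
    probeInput q a i ++ closingInput q a ∈ dyckTwoThree ↔ a i = true := by
  have h : List.ofFn a = (List.ofFn a).take i ++ a i :: (List.ofFn a).drop (i + 1) := by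
    conv_lhs => rw [← List.take_append_drop i (List.ofFn a)]
    rw [List.drop_eq_getElem_cons (by simp)]
    simp
  have := mem_dyckTwoThree_probe (q - 1 - i) q ((List.ofFn a).take i)
    ((List.ofFn a).drop (i + 1)) (a i)
  rwa [← h] at this

theorem StreamAlg.Computes.entropy_le {m q S : ℕ} (hmq : m ≤ q) {ε : ℝ} (hε₀ : 0 < ε)
    (hε₁ : ε < 1 / 2) (M : StreamAlg Paren S)
    (hM : M.Computes ε interleavedStream (dyckFun (m + 2 * q))) :
    m * (Real.log 2 - Real.binEntropy ε) ≤ S * Real.log 2 := by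
  let x : (Fin m → Bool) → Fin m → Fin (m + 2 * q) → Paren := fun a i j =>
    (probeInput q a i).get (j.cast (length_probeInput hmq a i).symm)
  let y : (Fin m → Bool) → Fin (m + 2 * q) → Paren := fun a j =>
    (closingInput q a).get (j.cast (length_closingInput a).symm)
  have hx : ∀ a i, List.ofFn (x a i) = probeInput q a i := fun a i =>
    List.ofFn_get_cast _ (length_probeInput hmq a i)
  have hy : ∀ a, List.ofFn (y a) = closingInput q a := fun a =>
    List.ofFn_get_cast _ (length_closingInput a)
  have hf : ∀ a i, dyckFun (m + 2 * q) (x a i) (y a) = a i := by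
    intro a i
    have := probeInput_append_mem_iff q a i
    rw [dyckFun, hx, hy]
    simp [this]
  -- The stream is cut after `2m` symbols: `σ` is the memory there, and `D` runs the algorithm on
  -- the remainder.
  let σ : CoinString → (Fin m → Bool) → (Fin S → Bool) := fun r a =>
    ((((List.ofFn a).reverse.map Paren.op).zip ((List.ofFn a).map Paren.cl)).flatMap
      fun p => [p.1, p.2]).foldl (M.step r) (M.init r)
  let D : CoinString → (Fin S → Bool) → Fin m → (Fin m → Bool) → Bool := fun r s i a =>
    M.output r ((((probeWord (q - 1 - i) ((List.ofFn a).take i)).zip (nestedPairs q)).flatMap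
      fun p => [p.1, p.2]).foldl (M.step r) s)
  have hrun : ∀ r a i, M.run r (interleavedStream (x a i) (y a)) = D r (σ r a) i a := by
    intro r a i
    rw [interleavedStream_eq, hx, hy, probeInput, closingInput, List.zip_append (by simp),
      List.flatMap_append, StreamAlg.run, List.foldl_append]
  have hD : ∀ r s i a a', (∀ j < i, a j = a' j) → D r s i a = D r s i a' := by
    intro r s i a a' h
    have : (List.ofFn a).take i = (List.ofFn a').take i := by
      refine List.ext_getElem (by simp) fun k h₁ h₂ => ?_
      have hk : k < i := by
        have := h₁
        simp only [List.length_take] at this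
        omega
      simpa using h ⟨k, hk.trans i.2⟩ hk
    simp only [D, this]
  have hmeas : ∀ a i, MeasurableSet {r | D r (σ r a) i a ≠ a i} := by
    intro a i
    simp only [← hrun]
    exact M.measurable_run _ (measurableSet_singleton (a i)).compl
  have hprob : ∀ a i, coinMeasure.real {r | D r (σ r a) i a ≠ a i} ≤ ε := by
    intro a i
    have := hM (x a i) (y a)
    simpa only [hf, hrun] using this
  have hint : ∀ a i, MeasureTheory.Integrable
      ({r | D r (σ r a) i a ≠ a i}.indicator fun _ => (1 : ℝ)) coinMeasure := fun a i =>
    (MeasureTheory.integrable_const 1).indicator (hmeas a i)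
  -- Some coin string makes at most the expected total number of errors over all pairs `(a, i)`.
  obtain ⟨r, hr⟩ := MeasureTheory.exists_le_integral
    (μ := coinMeasure) (f := fun r => ∑ a, ∑ i, {r | D r (σ r a) i a ≠ a i}.indicator
      (fun _ => (1 : ℝ)) r)
    (MeasureTheory.integrable_finsetSum _ fun a _ =>
      MeasureTheory.integrable_finsetSum _ fun i _ => hint a i)
  refine entropy_le_of_errors_le hε₀ hε₁ (σ r) (D r) (hD r) ?_
  have hsum : ∫ r, ∑ a, ∑ i, {r | D r (σ r a) i a ≠ a i}.indicator (fun _ => (1 : ℝ)) r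
      ∂coinMeasure ≤ ε * m * 2 ^ m := by
    rw [MeasureTheory.integral_finsetSum _ fun a _ =>
      MeasureTheory.integrable_finsetSum _ fun i _ => hint a i]
    calc _ ≤ ∑ a : Fin m → Bool, ∑ i : Fin m, ε := by
          refine Finset.sum_le_sum fun a _ => ?_
          rw [MeasureTheory.integral_finsetSum _ fun i _ => hint a i]
          refine Finset.sum_le_sum fun i _ => ?_
          rw [MeasureTheory.integral_indicator_const _ (hmeas a i)]
          simpa using hprob a i
      _ = ε * m * 2 ^ m := by simp; ring
  refine le_trans (le_of_eq ?_) (hr.trans hsum)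
  refine Finset.sum_congr rfl fun a _ => ?_
  simp only [Set.indicator_apply, Set.mem_ofPred_eq, Finset.sum_boole]

theorem interleavedStream_lower_bound {ε : ℝ} (hε₀ : 0 < ε) (hε₁ : ε < 1 / 2) :
    ∃ c : ℝ, 0 < c ∧ ∀ᶠ n : ℕ in Filter.atTop, ∀ (S : ℕ) (M : StreamAlg Paren S),
      M.Computes ε interleavedStream (dyckFun n) → c * (n : ℝ) ≤ (S : ℝ) := by
  have hlog : 0 < Real.log 2 := Real.log_pos one_lt_two
  have hH : 0 < Real.log 2 - Real.binEntropy ε :=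
    sub_pos.mpr (Real.binEntropy_lt_log_two.mpr (by norm_num at hε₁ ⊢; exact hε₁.ne))
  refine ⟨(Real.log 2 - Real.binEntropy ε) / (4 * Real.log 2), by positivity, ?_⟩
  filter_upwards [Filter.eventually_ge_atTop 16] with n hn S M hM
  -- Here `q` is `n / 3` rounded up and `m` lies between `q - 2` and `q`, so `n ≤ 4 * m` from `n =
  -- 16` on.
  obtain ⟨m, q, rfl, hmq, hm⟩ : ∃ m q, n = m + 2 * q ∧ m ≤ q ∧ n ≤ 4 * m :=
    ⟨n - 2 * ((n + 2) / 3), (n + 2) / 3, by omega, by omega, by omega⟩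
  have h := hM.entropy_le hmq hε₀ hε₁
  have hm' : ((m + 2 * q : ℕ) : ℝ) ≤ 4 * m := by exact_mod_cast hm
  rw [div_mul_eq_mul_div, div_le_iff₀ (by positivity)]
  nlinarith [mul_le_mul_of_nonneg_left hm' hH.le]

/-! ### A fingerprinting machine -/

/-- The value of a letter in a ring. -/
def letterValue (R : Type*) [Ring R] (t : Bool) : R := if t then 1 else 0

/-- Configurations of the machine: number of symbols read, positions of the unmatched opening
parentheses, whether the last symbol was an opening one, number of blocks of opening parentheses,
fingerprint. -/
structure FingerprintState (R : Type*) where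
  /-- number of symbols read -/
  pos : ℕ
  /-- positions of the unmatched opening parentheses, the last one first -/
  stack : List ℕ
  /-- whether the last symbol is an opening parenthesis -/
  last : Bool
  /-- number of blocks of opening parentheses -/
  blocks : ℕ
  /-- accumulated fingerprint -/
  acc : R

namespace FingerprintState

variable {R : Type*} [Ring R]

/-- One step of the machine; `none` means rejection. -/
def step (z : R) : Option (FingerprintState R) → Paren → Option (FingerprintState R)
  | none, _ => none
  | some s, .op t =>
    if (if s.last then s.blocks else s.blocks + 1) ≤ 3 then
      some ⟨s.pos + 1, s.pos :: s.stack, true, if s.last then s.blocks else s.blocks + 1,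
        s.acc - letterValue R t * z ^ s.pos⟩
    else none
  | some ⟨_, [], _, _, _⟩, .cl _ => none
  | some ⟨j, p :: st, _, b, a⟩, .cl t => some ⟨j + 1, st, false, b, a + letterValue R t * z ^ p⟩

/-- The initial configuration. -/
def start (R : Type*) [Ring R] : FingerprintState R := ⟨0, [], false, 0, 0⟩

/-- The accepting configurations. -/
def Accepts (s : Option (FingerprintState R)) : Prop :=
  ∃ s' : FingerprintState R, s = some s' ∧ s'.stack = [] ∧ s'.acc = 0

/-- The word closes exactly `h` parentheses that it does not open. -/
def Balanced : ℕ → List Paren → Prop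
  | h, [] => h = 0
  | h, .op _ :: w => Balanced (h + 1) w
  | 0, .cl _ :: _ => False
  | h + 1, .cl _ :: w => Balanced h w

/-- The contribution of a word, read at position `j` with the given stack, to the fingerprint. -/
def hash (z : R) : ℕ → List ℕ → List Paren → R
  | _, _, [] => 0
  | j, st, .op t :: w => hash z (j + 1) (j :: st) w - letterValue R t * z ^ j
  | _, [], .cl _ :: _ => 0
  | j, p :: st, .cl t :: w => hash z (j + 1) st w + letterValue R t * z ^ p

theorem foldl_step_none (z : R) (w : List Paren) : w.foldl (step z) none = none := by
  induction w with
  | nil => rfl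
  | cons p w ih => simpa [step] using ih

theorem not_accepts_none : ¬ Accepts (none : Option (FingerprintState R)) := by
  simp [Accepts]

theorem accepts_foldl_iff (z : R) (w : List Paren) (s : FingerprintState R) (hs : s.blocks ≤ 3) :
    Accepts (w.foldl (step z) (some s)) ↔ Balanced s.stack.length w ∧
      s.blocks + openingBlocks s.last w ≤ 3 ∧ s.acc + hash z s.pos s.stack w = 0 := by
  induction w generalizing s with
  | nil => simp [Accepts, Balanced, openingBlocks, hash, hs]
  | cons p w ih =>
    obtain ⟨j, st, b, c, a⟩ := s
    simp only at hs
    cases p with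
    | op t =>
      cases b with
      | true =>
        have := ih ⟨j + 1, j :: st, true, c, a - letterValue R t * z ^ j⟩ hs
        simp only [List.foldl_cons, step, hs, if_true, this, Balanced, openingBlocks, hash,
          List.length_cons]
        rw [show a + (hash z (j + 1) (j :: st) w - letterValue R t * z ^ j) =
          a - letterValue R t * z ^ j + hash z (j + 1) (j :: st) w by abel]
      | false =>
        by_cases hc : c + 1 ≤ 3
        · have := ih ⟨j + 1, j :: st, true, c + 1, a - letterValue R t * z ^ j⟩ hc
          simp only [List.foldl_cons, step, hc, if_true, this, Balanced, openingBlocks, hash,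
            List.length_cons, Bool.false_eq_true, if_false]
          rw [show a + (hash z (j + 1) (j :: st) w - letterValue R t * z ^ j) =
            a - letterValue R t * z ^ j + hash z (j + 1) (j :: st) w by abel,
            show c + 1 + openingBlocks true w = c + (openingBlocks true w + 1) by omega]
        · simp only [List.foldl_cons, step, hc, if_false, foldl_step_none, not_accepts_none,
            openingBlocks, Bool.false_eq_true, false_iff]
          rintro ⟨-, h, -⟩
          omega
    | cl t =>
      cases st with
      | nil => simp [step, foldl_step_none, not_accepts_none, Balanced]
      | cons p st =>
        have := ih ⟨j + 1, st, false, c, a + letterValue R t * z ^ p⟩ hs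
        simp only [List.foldl_cons, step, this, Balanced, openingBlocks, hash, List.length_cons]
        rw [show a + (hash z (j + 1) st w + letterValue R t * z ^ p) =
          a + letterValue R t * z ^ p + hash z (j + 1) st w by abel]

theorem accepts_start_iff (z : R) (w : List Paren) :
    Accepts (w.foldl (step z) (some (start R))) ↔
      Balanced 0 w ∧ openingBlocks false w ≤ 3 ∧ hash z 0 [] w = 0 := by
  simpa [start] using accepts_foldl_iff z w (start R) (by simp [start])

/-! ### The fingerprint as a polynomial -/

open Polynomial

variable {F : Type*} [Field F]

theorem map_letterValue {A B : Type*} [Ring A] [Ring B] (f : A →+* B) (t : Bool) :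
    f (letterValue A t) = letterValue B t := by
  cases t <;> simp [letterValue]

theorem eval_hash (z : F) (j : ℕ) (st : List ℕ) (w : List Paren) :
    (hash (X : F[X]) j st w).eval z = hash z j st w := by
  have hval : ∀ t, (letterValue F[X] t).eval z = letterValue F t :=
    fun t => map_letterValue (evalRingHom z) t
  induction w generalizing j st with
  | nil => simp [hash]
  | cons p w ih =>
    cases p with
    | op t => simp [hash, ih, hval]
    | cl t => cases st <;> simp [hash, ih, hval]

theorem letterValue_eq_C (t : Bool) : letterValue F[X] t = C (letterValue F t) := by
  cases t <;> simp [letterValue]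

theorem natDegree_hash_le (N j : ℕ) (st : List ℕ) (w : List Paren) (hj : j + w.length ≤ N)
    (hst : ∀ p ∈ st, p ≤ N) : (hash (X : F[X]) j st w).natDegree ≤ N := by
  induction w generalizing j st with
  | nil => simp [hash]
  | cons p w ih =>
    rw [List.length_cons] at hj
    have hterm : ∀ t : Bool, ∀ i ≤ N, (letterValue F[X] t * X ^ i).natDegree ≤ N := by
      intro t i hi
      rw [letterValue_eq_C]
      exact (natDegree_C_mul_X_pow_le _ _).trans hi
    cases p with
    | op t =>
      refine (natDegree_sub_le _ _).trans (max_le (ih _ _ (by omega) ?_) (hterm t j (by omega)))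
      simpa using ⟨by omega, hst⟩
    | cl t =>
      cases st with
      | nil => simp [hash]
      | cons p st =>
        obtain ⟨hp, hst⟩ := List.forall_mem_cons.mp hst
        exact (natDegree_add_le _ _).trans (max_le (ih _ _ (by omega) hst) (hterm t p hp))

/-- Future exponents are either new positions, at least `j`, or positions on the stack; a popped
position never recurs. -/
theorem coeff_hash_eq_zero (q j : ℕ) (st : List ℕ) (w : List Paren) (hq : q < j) (hst : q ∉ st) :
    (hash (X : F[X]) j st w).coeff q = 0 := by
  induction w generalizing j st with
  | nil => simp [hash]
  | cons p w ih =>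
    cases p with
    | op t =>
      have := ih (j + 1) (j :: st) (by omega) (by simp [hst, hq.ne])
      simp [hash, this, letterValue_eq_C, coeff_X_pow, hq.ne]
    | cl t =>
      cases st with
      | nil => simp [hash]
      | cons p st =>
        obtain ⟨hp, hst⟩ := not_or.mp (List.mem_cons.not.mp hst)
        simp [hash, ih (j + 1) st (by omega) hst, letterValue_eq_C, coeff_X_pow, hp]

/-- The polynomial describing a stack of positions and their letters. -/
noncomputable def stackPolynomial (F : Type*) [Field F] (l : List (ℕ × Bool)) : F[X] :=
  (l.map fun p => letterValue F[X] p.2 * X ^ p.1).sum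

theorem stackPolynomial_cons (p : ℕ × Bool) (l : List (ℕ × Bool)) :
    stackPolynomial F (p :: l) = letterValue F[X] p.2 * X ^ p.1 + stackPolynomial F l := by
  simp [stackPolynomial]

theorem coeff_stackPolynomial_eq_zero (q : ℕ) (l : List (ℕ × Bool)) (h : q ∉ l.map Prod.fst) :
    (stackPolynomial F l).coeff q = 0 := by
  induction l with
  | nil => simp [stackPolynomial]
  | cons p l ih =>
    obtain ⟨hp, hl⟩ := not_or.mp (List.mem_cons.not.mp h)
    simp [stackPolynomial_cons, ih hl, letterValue_eq_C, coeff_X_pow, hp]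

/-- `stackPolynomial` is what the pending openings still owe: the rest of the word must repay each
letter at its own position. -/
theorem matches_iff_hash_eq (w : List Paren) (j : ℕ) (l : List (ℕ × Bool))
    (hl : ∀ p ∈ l.map Prod.fst, p < j) (hnd : (l.map Prod.fst).Nodup) :
    Matches (l.map Prod.snd) w ↔ Balanced l.length w ∧
      hash (X : F[X]) j (l.map Prod.fst) w = stackPolynomial F l := by
  induction w generalizing j l with
  | nil =>
    cases l <;> simp [Matches, Balanced, hash, stackPolynomial]
  | cons p w ih =>
    cases p with
    | op t =>
      have := ih (j + 1) ((j, t) :: l)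
        (by
          rw [List.map_cons, List.forall_mem_cons]
          exact ⟨by simp, fun p hp => (hl p hp).trans (Nat.lt_succ_self j)⟩)
        (by
          rw [List.map_cons, List.nodup_cons]
          exact ⟨fun h => (hl j h).false, hnd⟩)
      simp only [List.map_cons, List.length_cons, stackPolynomial_cons] at this
      simp only [Matches, this, Balanced, hash, sub_eq_iff_eq_add']
    | cl t =>
      rcases l with _ | ⟨⟨q, t'⟩, l⟩
      · simp [Matches, Balanced]
      · simp only [List.map_cons, List.forall_mem_cons, List.nodup_cons] at hl hnd
        have hl' : ∀ p ∈ l.map Prod.fst, p < j + 1 := fun p hp =>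
          (hl.2 p hp).trans (Nat.lt_succ_self j)
        simp only [List.map_cons, Matches, List.length_cons, Balanced, hash, stackPolynomial_cons,
          ih (j + 1) l hl' hnd.2]
        constructor
        · rintro ⟨rfl, hb, h⟩
          exact ⟨hb, by rw [h, add_comm]⟩
        · rintro ⟨hb, h⟩
          -- Positions being distinct, only the pair matched now contributes to `X ^ q`, and `0 ≠ 1`
          -- in `F` makes the letters equal.
          have hc := congrArg (fun p => p.coeff q) h
          simp only [coeff_add, letterValue_eq_C, coeff_C_mul, coeff_X_pow, if_true, mul_one,
            coeff_hash_eq_zero q (j + 1) _ w (hl.1.trans (Nat.lt_succ_self j)) hnd.1,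
            coeff_stackPolynomial_eq_zero q l hnd.1, zero_add, add_zero] at hc
          obtain rfl : t = t' := by
            revert hc
            cases t <;> cases t' <;> simp [letterValue]
          exact ⟨rfl, hb, by rw [add_comm] at h; exact add_left_cancel h⟩

theorem mem_dyckTwoThree_iff_hash (F : Type*) [Field F] (w : List Paren) :
    w ∈ dyckTwoThree ↔
      Balanced 0 w ∧ openingBlocks false w ≤ 3 ∧ hash (X : F[X]) 0 [] w = 0 := by
  have := matches_iff_hash_eq (F := F) w 0 [] (by simp) (by simp)
  simp only [List.map_nil, List.length_nil, stackPolynomial, List.sum_nil] at this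
  rw [mem_dyckTwoThree_iff, this]
  tauto

/-! ### Reachable configurations -/

/-- A stack that is a union of intervals, given by their first points and their lengths. -/
def intervalStack (L : List (ℕ × ℕ)) : List ℕ :=
  L.flatMap fun p => (List.range' p.1 p.2).reverse

theorem intervalStack_cons (p : ℕ × ℕ) (L : List (ℕ × ℕ)) :
    intervalStack (p :: L) = (List.range' p.1 p.2).reverse ++ intervalStack L := rfl

theorem intervalStack_append_replicate (L : List (ℕ × ℕ)) (k : ℕ) :
    intervalStack (L ++ List.replicate k (0, 0)) = intervalStack L := by
  simp [intervalStack]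

/-- A pop shortens the first nonempty interval. Emptied intervals are kept, so that the number of
intervals stays equal to the number of blocks. -/
theorem exists_intervalStack_tail (N p : ℕ) (st : List ℕ) (L : List (ℕ × ℕ))
    (h : p :: st = intervalStack L) (hL : ∀ i ∈ L, i.1 + i.2 ≤ N) :
    ∃ L', L'.length = L.length ∧ st = intervalStack L' ∧ ∀ i ∈ L', i.1 + i.2 ≤ N := by
  induction L with
  | nil => simp [intervalStack] at h
  | cons i L ih =>
    obtain ⟨a, l⟩ := i
    obtain ⟨hi, hL₁⟩ := List.forall_mem_cons.mp hL
    rw [intervalStack_cons] at h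
    obtain _ | l := l
    · obtain ⟨L', hlen, hst, hL'⟩ := ih (by simpa using h) hL₁
      exact ⟨(a, 0) :: L', by simp [hlen], by simpa [intervalStack_cons] using hst,
        List.forall_mem_cons.mpr ⟨hi, hL'⟩⟩
    · rw [List.range'_concat, List.reverse_append] at h
      refine ⟨(a, l) :: L, rfl, ?_, List.forall_mem_cons.mpr ⟨?_, hL₁⟩⟩
      · simpa [intervalStack_cons] using (List.cons.inj h).2
      · simp only at hi ⊢
        omega

/-- The invariant satisfied by the reachable configurations. -/
def Reachable (s : FingerprintState R) : Prop :=
  s.blocks ≤ 3 ∧ ∃ L : List (ℕ × ℕ), L.length = s.blocks ∧ s.stack = intervalStack L ∧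
    (∀ i ∈ L, i.1 + i.2 ≤ s.pos) ∧
    (s.last = true → ∃ i L', L = i :: L' ∧ i.1 + i.2 = s.pos)

/-- An opening after an opening extends the top interval, which ends at the current position; any
other opening starts an interval and a block together. -/
theorem Reachable.step (z : R) {s s' : FingerprintState R} (h : Reachable s) (p : Paren)
    (hs : step z (some s) p = some s') : Reachable s' ∧ s'.pos = s.pos + 1 := by
  obtain ⟨j, st, b, c, a⟩ := s
  obtain ⟨hc, L, hlen, hst, hL, hlast⟩ := h
  simp only at hc hlen hst hL hlast
  cases p with
  | op t =>
    rw [FingerprintState.step] at hs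
    have h₂ := (Option.ite_none_right_eq_some.mp hs).1
    obtain rfl := Option.some.inj (Option.ite_none_right_eq_some.mp hs).2
    simp only at h₂
    by_cases h₁ : b = true
    · obtain ⟨⟨i, l⟩, L', rfl, hi⟩ := hlast h₁
      simp only at hi
      have hL₁ := (List.forall_mem_cons.mp hL).2
      refine ⟨⟨by simpa [h₁] using h₂, (i, l + 1) :: L', by simpa [h₁] using hlen, ?_, ?_,
        fun _ => ⟨_, _, rfl, ?_⟩⟩, rfl⟩
      · simp only [hst, intervalStack_cons, List.range'_concat, List.reverse_append]
        simp [hi]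
      · refine List.forall_mem_cons.mpr ⟨?_, fun i hi => ?_⟩
        · simp only; omega
        · have := hL₁ i hi
          simp only; omega
      · simp only; omega
    · refine ⟨⟨by simpa [h₁] using h₂, (j, 1) :: L, by simpa [h₁] using hlen, ?_, ?_,
        fun _ => ⟨_, _, rfl, rfl⟩⟩, rfl⟩
      · simp [hst, intervalStack_cons]
      · refine List.forall_mem_cons.mpr ⟨le_rfl, fun i hi => ?_⟩
        have := hL i hi
        simp only; omega
  | cl t =>
    cases st with
    | nil => simp [FingerprintState.step] at hs
    | cons p st =>
      obtain rfl := Option.some.inj hs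
      obtain ⟨L', hlen', hst', hL'⟩ := exists_intervalStack_tail j p st L hst hL
      refine ⟨⟨hc, L', hlen'.trans hlen, hst', fun i hi => ?_, by simp⟩, rfl⟩
      exact (hL' i hi).trans (Nat.le_succ j)

theorem reachable_start : Reachable (start R) :=
  ⟨by simp [start], [], rfl, rfl, by simp, by simp [start]⟩

theorem reachable_foldl (z : R) (w : List Paren) (s s' : FingerprintState R) (h : Reachable s)
    (hs : w.foldl (FingerprintState.step z) (some s) = some s') :
    Reachable s' ∧ s'.pos = s.pos + w.length := by
  induction w generalizing s with
  | nil =>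
    obtain rfl := Option.some.inj hs
    exact ⟨h, rfl⟩
  | cons p w ih =>
    rw [List.foldl_cons] at hs
    rcases hp : FingerprintState.step z (some s) p with _ | s₁
    · simp [hp, foldl_step_none] at hs
    · rw [hp] at hs
      obtain ⟨h₁, hpos⟩ := h.step z p hp
      obtain ⟨h₂, hpos'⟩ := ih s₁ h₁ hs
      exact ⟨h₂, by rw [hpos', hpos, List.length_cons]; omega⟩

/-- Compressed configurations with numbers below `B`. -/
abbrev Code (B : ℕ) (R : Type*) : Type _ :=
  Fin B × Bool × Fin 4 × (Fin 3 → Fin B × Fin B) × R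

/-- The configuration described by a code. -/
def decode {B : ℕ} (c : Code B R) : FingerprintState R :=
  ⟨c.1, intervalStack (List.ofFn fun i => ((c.2.2.2.1 i).1.val, (c.2.2.2.1 i).2.val)),
    c.2.1, c.2.2.1, c.2.2.2.2⟩

theorem Reachable.exists_decode {T : Type*} {B : ℕ} {s : FingerprintState T} (h : Reachable s)
    (hB : s.pos < B) : ∃ c : Code B T, decode c = s := by
  obtain ⟨j, st, b, k, a⟩ := s
  obtain ⟨hk, L, hlen, hst, hL, -⟩ := h
  simp only at hB hk hlen hst hL
  have hlen' : (L ++ List.replicate (3 - k) (0, 0)).length = 3 := by simp [hlen]; omega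
  have hL' : ∀ i ∈ L ++ List.replicate (3 - k) (0, 0), i.1 + i.2 < B := by
    intro i hi
    rcases List.mem_append.mp hi with hi | hi
    · exact (hL i hi).trans_lt hB
    · obtain rfl := List.eq_of_mem_replicate hi
      simp only; omega
  have hget : ∀ i : Fin 3, ((L ++ List.replicate (3 - k) (0, 0)).get (i.cast hlen'.symm)).1 +
      ((L ++ List.replicate (3 - k) (0, 0)).get (i.cast hlen'.symm)).2 < B :=
    fun i => hL' _ (List.get_mem _ _)
  refine ⟨(⟨j, hB⟩, b, ⟨k, by omega⟩, fun i =>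
    (⟨_, (Nat.le_add_right _ _).trans_lt (hget i)⟩,
      ⟨_, (Nat.le_add_left _ _).trans_lt (hget i)⟩), a), ?_⟩
  simp only [decode, Prod.mk.eta]
  rw [List.ofFn_get_cast _ hlen', intervalStack_append_replicate, ← hst]

end FingerprintState

/-! ### The streaming algorithm -/

theorem coinMeasure_prefix_le (k : ℕ) (V : Finset (Fin k → Bool)) :
    coinMeasure.real {r | (fun i : Fin k => r i) ∈ V} ≤ V.card / 2 ^ k := by
  have hsub : {r : CoinString | (fun i : Fin k => r i) ∈ V} ⊆
      ⋃ v ∈ V, {r | ∀ i : Fin k, r i = v i} := by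
    intro r hr
    exact Set.mem_biUnion hr fun i => rfl
  have hone : ∀ v : Fin k → Bool,
      coinMeasure.real {r | ∀ i : Fin k, r i = v i} = (1 / 2) ^ k := by
    intro v
    have hset : {r : CoinString | ∀ i : Fin k, r i = v i} =
        -- The value `true` is a dummy: only indices below `k` occur.
        Set.pi (Finset.range k) fun i => {if h : i < k then v ⟨i, h⟩ else true} := by
      ext r
      simp only [Set.mem_ofPred_eq, Set.mem_pi, Finset.coe_range, Set.mem_Iio,
        Set.mem_singleton_iff]
      constructor
      · intro h i hi
        simpa [hi] using h ⟨i, hi⟩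
      · intro h i
        simpa using h i i.2
    rw [hset, MeasureTheory.measureReal_def, coinMeasure,
      MeasureTheory.Measure.infinitePi_pi _ fun _ _ => measurableSet_singleton _]
    simp only [PMF.toMeasure_apply_singleton _ _ (measurableSet_singleton _),
      PMF.uniformOfFintype_apply, Fintype.card_bool, Finset.prod_const, Finset.card_range,
      ENNReal.toReal_pow, ENNReal.toReal_inv, Nat.cast_ofNat, ENNReal.toReal_ofNat, one_div]
  calc coinMeasure.real {r | (fun i : Fin k => r i) ∈ V}
      ≤ coinMeasure.real (⋃ v ∈ V, {r | ∀ i : Fin k, r i = v i}) :=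
        MeasureTheory.measureReal_mono hsub (MeasureTheory.measure_ne_top _ _)
    _ ≤ ∑ v ∈ V, coinMeasure.real {r | ∀ i : Fin k, r i = v i} :=
        MeasureTheory.measureReal_biUnion_finset_le _ _
    _ = V.card / 2 ^ k := by
        rw [Finset.sum_congr rfl fun v _ => hone v, Finset.sum_const, nsmul_eq_mul, one_div, inv_pow,
          div_eq_mul_inv]

/-- A machine whose configurations on short words are described by `S` bits yields a streaming
algorithm with `S` bits of memory. -/
theorem exists_streamAlg_of_decode {A Q : Type} [Nonempty Q] {S k N : ℕ}
    (decode : (Fin S → Bool) → Q) (init : (Fin k → Bool) → Q) (step : Q → A → Q)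
    (output : Q → Bool)
    (h : ∀ v (w : List A), w.length ≤ N → w.foldl step (init v) ∈ Set.range decode) :
    ∃ M : StreamAlg A S, M.CoinsOnlyAtStart ∧ ∀ r (w : List A), w.length ≤ N →
      M.run r w = output (w.foldl step (init fun i => r i)) := by
  -- `Function.invFun decode` encodes faithfully only on the range of `decode`, hence the need to
  -- control every prefix of the word.
  have hinv : ∀ s ∈ Set.range decode, decode (Function.invFun decode s) = s :=
    fun s hs => Function.invFun_eq hs
  let M : StreamAlg A S :=
    { init := fun r => Function.invFun decode (init fun i => r i)
      step := fun _ σ a => Function.invFun decode (step (decode σ) a)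
      output := fun _ σ => output (decode σ)
      measurable_init := (measurable_of_countable fun v : Fin k → Bool =>
        Function.invFun decode (init v)).comp (measurable_pi_lambda _ fun i =>
          measurable_pi_apply _)
      measurable_step := fun _ _ => measurable_const
      measurable_output := fun _ => measurable_const }
  refine ⟨M, fun _ _ => ⟨rfl, rfl⟩, fun r w hw => ?_⟩
  have key : ∀ w : List A, w.length ≤ N →
      decode (w.foldl (M.step r) (M.init r)) = w.foldl step (init fun i => r i) := by
    intro w
    induction w using List.reverseRecOn with
    | nil => exact fun hw => hinv _ (h _ [] hw)
    | append_singleton w a ih =>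
      intro hw
      have hw' : w.length ≤ N := by
        rw [List.length_append] at hw
        omega
      have hr := h (fun i => r i) (w ++ [a]) hw
      rw [List.foldl_append, List.foldl_cons, List.foldl_nil] at hr ⊢
      rw [List.foldl_append, List.foldl_cons, List.foldl_nil, ← ih hw']
      rw [← ih hw'] at hr
      exact hinv _ hr
  exact congrArg output (key w hw)

namespace FingerprintState

open Polynomial

open Classical in
theorem exists_streamAlg_of_field {F : Type} [Field F] [Fintype F] {n b k : ℕ}
    (hF : Fintype.card F = 2 ^ k) (hb : 2 * n < 2 ^ b) :
    ∃ M : StreamAlg Paren (7 * b + 2 * k + 4), M.CoinsOnlyAtStart ∧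
      ∃ e : (Fin k → Bool) ≃ F, ∀ r (w : List Paren), w.length ≤ 2 * n →
        (M.run r w = true ↔ Balanced 0 w ∧ openingBlocks false w ≤ 3 ∧
          hash (e fun i => r i) 0 [] w = 0) := by
  obtain ⟨e⟩ : Nonempty ((Fin k → Bool) ≃ F) := Fintype.card_eq.mp (by simp [hF])
  obtain ⟨f⟩ : Nonempty (F × Option (Code (2 ^ b) F) ↪
      (Fin (7 * b + 2 * k + 4) → Bool)) := by
    refine Function.Embedding.nonempty_of_card_le ?_
    -- The point `z` takes `k` bits; a code takes `b + 1 + 2 + 6 * b + k`. One more bit accommodates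
    -- `none`.
    have h₁ : Fintype.card (F × Option (Code (2 ^ b) F)) =
        2 ^ k * (2 ^ (7 * b + k + 3) + 1) := by
      simp only [Fintype.card_prod, Fintype.card_option, Fintype.card_fin, Fintype.card_bool,
        Fintype.card_pi, Finset.prod_const, Finset.card_univ, hF]
      ring
    have h₂ : 2 ^ (7 * b + 2 * k + 4) = 2 ^ k * (2 * 2 ^ (7 * b + k + 3)) := by ring
    rw [h₁, Fintype.card_pi, Finset.prod_const, Fintype.card_bool, Finset.card_univ,
      Fintype.card_fin, h₂]
    gcongr
    have := Nat.one_le_two_pow (n := 7 * b + k + 3)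
    omega
  let unpack : F × Option (Code (2 ^ b) F) → F × Option (FingerprintState F) :=
    fun c => (c.1, c.2.map decode)
  have : Nonempty (F × Option (Code (2 ^ b) F)) := ⟨(0, none)⟩
  let machine : F × Option (FingerprintState F) → Paren → F × Option (FingerprintState F) :=
    fun s p => (s.1, step s.1 s.2 p)
  have hfold : ∀ (w : List Paren) z s, w.foldl machine (z, s) = (z, w.foldl (step z) s) := by
    intro w
    induction w with
    | nil => exact fun z s => rfl
    | cons p w ih => exact fun z s => ih z (step z s p)
  obtain ⟨M, hM, hrun⟩ := exists_streamAlg_of_decode (N := 2 * n)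
    (fun σ => unpack (Function.invFun f σ)) (fun v => (e v, some (start F))) machine
    (fun s => decide (Accepts s.2)) (by
      intro v w hw
      have hc : ∃ c, unpack c = w.foldl machine (e v, some (start F)) := by
        rw [hfold]
        rcases hs : w.foldl (step (e v)) (some (start F)) with _ | s
        · exact ⟨(e v, none), rfl⟩
        · obtain ⟨h, hpos⟩ := reachable_foldl _ w _ s reachable_start hs
          have hpos' : s.pos < 2 ^ b := by
            rw [hpos]
            simp only [start]
            omega
          obtain ⟨c, rfl⟩ := h.exists_decode hpos'
          exact ⟨(e v, some c), rfl⟩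
      obtain ⟨c, hc⟩ := hc
      obtain ⟨σ, rfl⟩ := Function.invFun_surjective f.injective c
      exact ⟨σ, hc⟩)
  refine ⟨M, hM, e, fun r w hw => ?_⟩
  rw [hrun r w hw, hfold, decide_eq_true_iff, accepts_start_iff]

/-- The error is one-sided. If the polynomial is zero the answer is always right; otherwise the word
is outside the language and is accepted only when `z` is one of at most `2n` roots. -/
theorem exists_streamAlg_computes {F : Type} [Field F] [Fintype F] {n b k : ℕ} {ε : ℝ}
    (hF : Fintype.card F = 2 ^ k) (hb : 2 * n < 2 ^ b) (hε : 2 * n / 2 ^ k ≤ ε) :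
    ∃ M : StreamAlg Paren (7 * b + 2 * k + 4), M.CoinsOnlyAtStart ∧
      M.Computes ε concatStream (dyckFun n) := by
  classical
  obtain ⟨M, hM, e, hrun⟩ := exists_streamAlg_of_field hF hb
  refine ⟨M, hM, fun x y => ?_⟩
  have hε₀ : 0 ≤ ε := le_trans (by positivity) hε
  set w := List.ofFn x ++ List.ofFn y with hw
  have hlen : w.length = 2 * n := by
    simp [hw]
    omega
  have hdyck : dyckFun n x y = true ↔ w ∈ dyckTwoThree := by simp [dyckFun, hw]
  have hmem := mem_dyckTwoThree_iff_hash F w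
  have heval : ∀ z : F, hash z 0 [] w = (hash (X : F[X]) 0 [] w).eval z := fun z =>
    (eval_hash z 0 [] w).symm
  have hgood : hash (X : F[X]) 0 [] w = 0 →
      {r | M.run r (concatStream x y) ≠ dyckFun n x y} = ∅ := by
    intro h0
    refine Set.eq_empty_of_forall_notMem fun r hr => hr ?_
    rw [Bool.eq_iff_iff, hdyck, hmem]
    change M.run r w = true ↔ _
    rw [hrun r w hlen.le, heval, h0, eval_zero, eq_self_iff_true, eq_self_iff_true]
  by_cases h0 : hash (X : F[X]) 0 [] w = 0
  · rw [hgood h0]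
    simpa using hε₀
  · have hsub : {r | M.run r (concatStream x y) ≠ dyckFun n x y} ⊆
        {r | (fun i : Fin k => r i) ∈
          (hash (X : F[X]) 0 [] w).roots.toFinset.map e.symm.toEmbedding} := by
      intro r hr
      have hfalse : dyckFun n x y = false := by
        rw [← Bool.not_eq_true, hdyck, hmem]
        exact fun h => h0 h.2.2
      have htrue : M.run r w = true := by
        have : M.run r w ≠ dyckFun n x y := hr
        rw [hfalse] at this
        simpa using this
      have hz := ((hrun r w hlen.le).mp htrue).2.2
      rw [heval] at hz
      simp only [Set.mem_ofPred_eq, Finset.mem_map, Multiset.mem_toFinset]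
      exact ⟨_, (mem_roots h0).mpr hz, e.symm_apply_apply _⟩
    have hcard : (((hash (X : F[X]) 0 [] w).roots.toFinset.map e.symm.toEmbedding).card : ℝ) ≤
        2 * n := by
      rw [Finset.card_map]
      exact_mod_cast (Multiset.toFinset_card_le _).trans ((card_roots' _).trans
        (natDegree_hash_le (2 * n) 0 [] w (by omega) (by simp)))
    calc _ ≤ _ := MeasureTheory.measureReal_mono hsub
      _ ≤ _ := coinMeasure_prefix_le k _
      _ ≤ 2 * n / 2 ^ k := by gcongr
      _ ≤ ε := hε

end FingerprintState

theorem concatStream_upper_bound {ε : ℝ} (hε₀ : 0 < ε) :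
    ∃ C : ℝ, ∀ᶠ n : ℕ in Filter.atTop, ∃ S : ℕ, (S : ℝ) ≤ C * Real.log n ∧
      ∃ M : StreamAlg Paren S, M.CoinsOnlyAtStart ∧ M.Computes ε concatStream (dyckFun n) := by
  obtain ⟨e, he⟩ := exists_pow_lt_of_lt_one hε₀ (show (1 / 2 : ℝ) < 1 by norm_num)
  have hlog : 0 < Real.log 2 := Real.log_pos one_lt_two
  -- The memory is `9 * b + (2 * e + 4)` with `b ≤ 2 * log n / log 2`, which comes from `2 ^ b ≤ 4 *
  -- n ≤ n * n`.
  refine ⟨18 / Real.log 2 + (2 * e + 4), ?_⟩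
  filter_upwards [Filter.eventually_ge_atTop 4] with n hn
  set b := Nat.log 2 (2 * n) + 1 with hb
  have hb₁ : 2 * n < 2 ^ b := Nat.lt_pow_succ_log_self one_lt_two _
  have hb₂ : 2 ^ b ≤ n * n := by
    have := Nat.pow_log_le_self 2 (show 2 * n ≠ 0 by omega)
    rw [hb, pow_succ]
    nlinarith
  have hbn : (b : ℝ) * Real.log 2 ≤ 2 * Real.log n := by
    have h : ((2 ^ b : ℕ) : ℝ) ≤ ((n * n : ℕ) : ℝ) := Nat.cast_le.mpr hb₂
    push_cast at h
    have := Real.log_le_log (by positivity) h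
    rw [Real.log_pow, ← pow_two, Real.log_pow] at this
    exact_mod_cast this
  have hn₁ : 1 ≤ Real.log n := by
    rw [Real.le_log_iff_exp_le (by positivity)]
    have : (4 : ℝ) ≤ n := by exact_mod_cast hn
    linarith [Real.exp_one_lt_d9]
  -- The `b` bits outweigh the `2n` possible roots; the `e` extra ones bring the error down to `(1 /
  -- 2) ^ e < ε`.
  let F := GaloisField 2 (b + e)
  have : Fintype F := Fintype.ofFinite F
  have hF : Fintype.card F = 2 ^ (b + e) := by
    rw [← Nat.card_eq_fintype_card]
    exact GaloisField.card 2 (b + e) (by omega)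
  have hε : (2 * n / 2 ^ (b + e) : ℝ) ≤ ε := by
    have h : (2 * n : ℝ) ≤ 2 ^ b := by exact_mod_cast hb₁.le
    calc (2 * n / 2 ^ (b + e) : ℝ) ≤ 2 ^ b / 2 ^ (b + e) := by gcongr
      _ = (1 / 2) ^ e := by
        rw [pow_add _ b e, one_div, inv_pow, div_mul_eq_div_div, div_self (by positivity), one_div]
      _ ≤ ε := he.le
  refine ⟨7 * b + 2 * (b + e) + 4, ?_,
    FingerprintState.exists_streamAlg_computes hF hb₁ hε⟩
  push_cast
  have h₁ : (b : ℝ) ≤ 2 / Real.log 2 * Real.log n := by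
    rw [div_mul_eq_mul_div, le_div_iff₀ hlog]
    exact hbn
  have h₂ : (2 * e + 4 : ℝ) ≤ (2 * e + 4) * Real.log n :=
    le_mul_of_one_le_right (by positivity) hn₁
  calc (7 * b + 2 * (b + e) + 4 : ℝ) = 9 * b + (2 * e + 4) := by ring
    _ ≤ 9 * (2 / Real.log 2 * Real.log n) + (2 * e + 4) * Real.log n := by gcongr
    _ = _ := by ring

theorem theorem1 (ε : ℝ) (hε₀ : 0 < ε) (hε₁ : ε < 1 / 2) :
    (∃ C : ℝ, ∀ᶠ n : ℕ in Filter.atTop, ∃ S : ℕ, (S : ℝ) ≤ C * Real.log n ∧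
      ∃ M : StreamAlg Paren S, M.CoinsOnlyAtStart ∧ M.Computes ε concatStream (dyckFun n)) ∧
    (∃ c : ℝ, 0 < c ∧ ∀ᶠ n : ℕ in Filter.atTop, ∀ (S : ℕ) (M : StreamAlg Paren S),
      M.Computes ε interleavedStream (dyckFun n) → c * (n : ℝ) ≤ (S : ℝ)) :=
  ⟨concatStream_upper_bound hε₀, interleavedStream_lower_bound hε₀ hε₁⟩
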